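/- Let $ABC$ be a triangle in the Euclidean plane with circumcircle $\Omega$, and let $P\ne P'$ be isogonal conjugates in $ABC$ (points of the plane, not on the side lines, such that at each vertex the directed angles modulo $180^\circ$ satisfy $\angle(AB,AP)=\angle(AP',AC)$ and cyclically). Let $Q$ lie on line $PP'$. A conic means the zero set of a nonzero real quadratic form in homogeneous coordinates (possibly degenerate), and $(VWXYZ)$ denotes the conic through the five points $V,W,X,Y,Z$. Suppose that $\Omega$ meets the circumconic $(ABCPP')$ at a point $D\ne A,B,C$, that line $DP$ meets $\Omega$ at a point $X\ne D$, and that $P,Q,X$ are not collinear; let $(PQX)$ be the circle through them. Then: (a) The circle $(PQX)$ and the circumconic $(ABCPQ)$ are tangent at $P$: the conic is smooth at $P$ and the two curves have the same tangent line there. (b) If $(PQX)$ and $(ABCPQ)$ also meet at a point $L\ne P,Q$, then line $PL$ and the conic $(ABCPX)$ have a common point lying on the radical axis of $\Omega$ and $(PQX)$. Here lines and conics are taken in the projective plane, so the common point may be at infinity. -/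

import Mathlib

open EuclideanGeometry
open scoped Matrix LinearAlgebra.Projectivization

/-- The Euclidean plane. -/
abbrev EPlane : Type := EuclideanSpace ℝ (Fin 2)

/-- The real projective plane, in homogeneous coordinates `[x : y : z]`;
the line `z = 0` is the line at infinity of `EPlane`. -/
abbrev PPlane : Type := ℙ ℝ (Fin 3 → ℝ)

instance EPlane.instFactFinrank : Fact (Module.finrank ℝ EPlane = 2) :=
  ⟨by simp⟩

/-- The standard (counterclockwise) orientation of the plane. -/
noncomputable instance EPlane.instOriented : Module.Oriented ℝ EPlane (Fin 2) :=
  ⟨(EuclideanSpace.basisFun (Fin 2) ℝ).toBasis.orientation⟩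

/-- `P` and `P'` are isogonal conjugates in triangle `ABC`: neither of them lies on a side line,
and at each vertex the lines to `P` and `P'` are isogonal with respect to the two sides.
Doubling an oriented angle turns equality of angles modulo `2π` into
equality of directed angles between lines, that is, equality modulo `π`. -/
structure IsIsogonalConjugate (A B C P P' : EPlane) : Prop where
  left_not_mem_BC : P ∉ line[ℝ, B, C]
  left_not_mem_CA : P ∉ line[ℝ, C, A]
  left_not_mem_AB : P ∉ line[ℝ, A, B]
  right_not_mem_BC : P' ∉ line[ℝ, B, C]
  right_not_mem_CA : P' ∉ line[ℝ, C, A]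
  right_not_mem_AB : P' ∉ line[ℝ, A, B]
  angle_A : (2 : ℤ) • ∡ B A P = (2 : ℤ) • ∡ P' A C
  angle_B : (2 : ℤ) • ∡ C B P = (2 : ℤ) • ∡ P' B A
  angle_C : (2 : ℤ) • ∡ A C P = (2 : ℤ) • ∡ P' C B

/-- Homogeneous coordinates `(x, y, 1)` of a point of the plane. -/
def EPlane.homog (p : EPlane) : Fin 3 → ℝ := ![p 0, p 1, 1]

/-- A (possibly degenerate) conic: the zero locus of a nonzero real quadratic form in three
homogeneous coordinates, given by its symmetric matrix. -/
structure Conic where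
  mat : Matrix (Fin 3) (Fin 3) ℝ
  symm : mat.IsSymm
  ne_zero : mat ≠ 0

namespace Conic

/-- The points of the conic in the projective plane. -/
def projPoints (K : Conic) : Set PPlane := {z | z.rep ⬝ᵥ K.mat *ᵥ z.rep = 0}

/-- The points of the conic in the Euclidean plane. -/
def points (K : Conic) : Set EPlane := {p | p.homog ⬝ᵥ K.mat *ᵥ p.homog = 0}

/-- The conic passes through five given points. -/
def Through (K : Conic) (V W X Y Z : EPlane) : Prop :=
  V ∈ K.points ∧ W ∈ K.points ∧ X ∈ K.points ∧ Y ∈ K.points ∧ Z ∈ K.points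

/-- `p` is a smooth point of the conic. -/
def IsSmoothAt (K : Conic) (p : EPlane) : Prop := p ∈ K.points ∧ K.mat *ᵥ p.homog ≠ 0

/-- The tangent line of the conic at a smooth point `p`, which is the polar line of `p`. -/
def tangentLine (K : Conic) (p : EPlane) : Set EPlane :=
  {r | r.homog ⬝ᵥ K.mat *ᵥ p.homog = 0}

end Conic

/-- The circle `ω` and the conic `K` are tangent at `p`: both pass through `p`, the conic is smooth
there, and they have the same tangent line at `p`. -/
def AreTangentAt (ω : Sphere EPlane) (K : Conic) (p : EPlane) : Prop :=
  p ∈ ω ∧ K.IsSmoothAt p ∧ (ω.orthRadius p : Set EPlane) = K.tangentLine p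

/-- The radical axis of two circles: the points with equal power with respect to both. -/
def radicalAxis (Ω ω : Sphere EPlane) : Set EPlane := {Z | Ω.power Z = ω.power Z}

/-- The projective completion of a line of the plane: the points of the line together with its
point at infinity. -/
def projLine (l : Set EPlane) : Set PPlane :=
  {z | z.rep ∈ Submodule.span ℝ (EPlane.homog '' l)}

/-! In the basis `p A, q B, r C`, where `P` is `(1, 1, 1)`, a circumconic through `P` is `α yz + β
zx + γ xy = 0` with `α + β + γ = 0`. Isogonality puts `P'` at `(s + u, s + v, s + w)` up to a factor
and gives `Ω` the form `S = p(s+u) yz + q(s+v) zx + r(s+w) xy`. Here `s` is the power of `P`, and `d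
= (u, v, w)` is the point at infinity of `PP'`. Isogonal conjugation sends `(ABCPP')` to line `PP'`
and `Ω` to the line at infinity, so `D` is the conjugate of `d` (`fourth_point_coords`). Hence `X =
ρ (vw + N, wu + N, uv + N)`, by `exists_second_point_factor`.

(a) On `Q - P = τ d` and on `X - P`, the tangent functional of `(ABCPQ)` at `P` takes the values
`-τ² σ` and `-ρ σ` with the same `σ = α vw + β wu + γ uv`. The squared lengths of these vectors are
`τ² S(d)` and `ρ S(d)`, and they determine the tangent functional of the circle. As the vectors are
independent, the two functionals are proportional.

(b) Line `PL` meets the radical axis at `Z = S(L) P - s L`, since the difference of powers is `s` at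
`P` and `S(L)` at `L`. That `Z` lies on `(ABCPX)` follows from the vanishing of one `onesDet`; the
conic `(ABCPQ)`, through `L` and tangent to the circle, makes another vanish. The identity
`onesDet_key` links the two, and `concurrence_key` draws the conclusion. -/

/-! ### Determinants and polynomial identities -/

/-- The determinant of the rows `(1, 1, 1)`, `(a, b, c)`, `(x, y, z)`. -/
def onesDet (a b c x y z : ℝ) : ℝ := (b * z - c * y) - (a * z - c * x) + (a * y - b * x)

lemma onesDet_eq_zero_of_orthogonal {α β γ a b c x y z : ℝ} (hne : ¬(α = 0 ∧ β = 0 ∧ γ = 0))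
    (h0 : α + β + γ = 0) (h1 : α * a + β * b + γ * c = 0) (h2 : α * x + β * y + γ * z = 0) :
    onesDet a b c x y z = 0 := by
  by_contra hd
  refine hne ⟨?_, ?_, ?_⟩ <;> refine (mul_eq_zero.1 ?_).resolve_left hd <;> unfold onesDet
  · linear_combination (b * z - c * y) * h0 + (y - z) * h1 + (c - b) * h2
  · linear_combination (c * x - a * z) * h0 + (z - x) * h1 + (a - c) * h2
  · linear_combination (a * y - b * x) * h0 + (x - y) * h1 + (b - a) * h2

/-- When the first two rows are independent, a vanishing determinant puts the third in their span,
hence in the plane orthogonal to `(α, β, γ)`. -/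
lemma orthogonal_of_onesDet_eq_zero {α β γ a b c x y z : ℝ} (hne : ¬(a = b ∧ b = c))
    (h0 : α + β + γ = 0) (h1 : α * a + β * b + γ * c = 0) (hd : onesDet a b c x y z = 0) :
    α * x + β * y + γ * z = 0 := by
  by_contra hT
  unfold onesDet at hd
  have key : a = b ∧ b = c := by
    constructor <;> refine sub_eq_zero.1 ((mul_eq_zero.1 ?_).resolve_left hT)
    · linear_combination -γ * hd + (a * y - b * x) * h0 + (x - y) * h1
    · linear_combination -α * hd + (b * z - c * y) * h0 + (y - z) * h1
  exact hne key

/-- Since `(p, q, r)` is orthogonal to `(u, v, w)` and `(x, y, z)` and has sum `1`, it is their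
cross product divided by `θ = onesDet u v w x y z`. Eliminating `p, q, r` in this way leaves an
identity in free variables. -/
lemma onesDet_key {p q r s u v w x y z : ℝ} (hpqr : p + q + r = 1)
    (hθ : onesDet u v w x y z ≠ 0)
    (hd : p * u + q * v + r * w = 0) (hf : p * x + q * y + r * z = 0)
    {S : ℝ → ℝ → ℝ → ℝ}
    (hS : ∀ x y z, S x y z = p * (s + u) * (y * z) + q * (s + v) * (z * x) + r * (s + w) * (x * y))
    {N W : ℝ} (hN : N = p * u ^ 2 + q * v ^ 2 + r * w ^ 2)
    (hW : W = s * (x + y + z) - (p * u * x + q * v * y + r * w * z) + S x y z) :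
    onesDet (v * w * (u ^ 2 - N)) (w * u * (v ^ 2 - N)) (u * v * (w ^ 2 - N))
        (s * (y * z) + x * W) (s * (z * x) + y * W) (s * (x * y) + z * W) * onesDet u v w x y z =
      (u - v) * (v - w) * (w - u) *
      onesDet (x - y * z) (y - z * x) (z - x * y)
        (y * z * S u v w - v * w * S x y z) (z * x * S u v w - w * u * S x y z)
        (x * y * S u v w - u * v * S x y z) := by
  have h1 : p * onesDet u v w x y z = v * z - w * y := by
    unfold onesDet
    linear_combination (v * z - w * y) * hpqr + (y - z) * hd + (w - v) * hf
  have h2 : q * onesDet u v w x y z = w * x - u * z := by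
    unfold onesDet
    linear_combination (w * x - u * z) * hpqr + (z - x) * hd + (u - w) * hf
  have h3 : r * onesDet u v w x y z = u * y - v * x := by
    unfold onesDet
    linear_combination (u * y - v * x) * hpqr + (x - y) * hd + (v - u) * hf
  rw [← eq_div_iff hθ] at h1 h2 h3
  have hθ' : onesDet u v w x y z = (v * z - w * y) + (w * x - u * z) + (u * y - v * x) := by
    unfold onesDet; ring
  rw [hW, hS, hS, hN, h1, h2, h3]
  generalize onesDet u v w x y z = θ at *
  unfold onesDet
  field_simp
  subst hθ'
  ring

/-- If `θ = 0`, two vectors of the plane orthogonal to `(p, q, r)` are proportional. -/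
lemma proportional_of_onesDet_eq_zero {p q r u v w x y z : ℝ} (hpqr : p + q + r = 1)
    (hd : p * u + q * v + r * w = 0) (hf : p * x + q * y + r * z = 0)
    (hne : ¬(u = 0 ∧ v = 0 ∧ w = 0)) (hθ : onesDet u v w x y z = 0) :
    ∃ m, x = m * u ∧ y = m * v ∧ z = m * w := by
  unfold onesDet at hθ
  have h1 : v * z - w * y = 0 := by
    linear_combination p * hθ - (v * z - w * y) * hpqr - (y - z) * hd - (w - v) * hf
  have h2 : w * x - u * z = 0 := by
    linear_combination q * hθ - (w * x - u * z) * hpqr - (z - x) * hd - (u - w) * hf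
  have h3 : u * y - v * x = 0 := by
    linear_combination r * hθ - (u * y - v * x) * hpqr - (x - y) * hd - (v - u) * hf
  by_cases hu : u = 0
  · by_cases hv : v = 0
    · have hw : w ≠ 0 := fun hw => hne ⟨hu, hv, hw⟩
      refine ⟨z / w, ?_, ?_, ?_⟩ <;> field_simp <;> linarith
    · refine ⟨y / v, ?_, ?_, ?_⟩ <;> field_simp <;> linarith
  · refine ⟨x / u, ?_, ?_, ?_⟩ <;> field_simp <;> linarith

/-- Coordinates of the fourth common point of the circumcircle and the circumconic. -/
lemma fourth_point_coords {p q r s u v w h₁ h₂ h₃ x y z : ℝ} (hpqr : p + q + r = 1)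
    (hd : p * u + q * v + r * w = 0) (hne : ¬(u = 0 ∧ v = 0 ∧ w = 0))
    (hu : s + u ≠ 0) (hv : s + v ≠ 0) (hw : s + w ≠ 0)
    (hh : ¬(h₁ = 0 ∧ h₂ = 0 ∧ h₃ = 0)) (hP : h₁ + h₂ + h₃ = 0)
    (hP' : h₁ * ((s + v) * (s + w)) + h₂ * ((s + w) * (s + u)) + h₃ * ((s + u) * (s + v)) = 0)
    (hx : x ≠ 0) (hy : y ≠ 0) (hz : z ≠ 0)
    (hDH : h₁ * (y * z) + h₂ * (z * x) + h₃ * (x * y) = 0)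
    (hDS : p * (s + u) * (y * z) + q * (s + v) * (z * x) + r * (s + w) * (x * y) = 0) :
    u ≠ 0 ∧ v ≠ 0 ∧ w ≠ 0 ∧ ∃ δ : ℝ, x = δ * ((s + u) * (v * w)) ∧
      y = δ * ((s + v) * (w * u)) ∧ z = δ * ((s + w) * (u * v)) := by
  -- The map `x ↦ (s + u) / x`, and cyclically, is isogonal conjugation. It straightens the
  -- circumconic into the line through the images of `P`, `P'` and `D`. The image of `D` is at
  -- infinity because `D` lies on `Ω`, so it is proportional to `(u, v, w)`.
  have hθ : onesDet u v w ((s + u) / x) ((s + v) / y) ((s + w) / z) = 0 := by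
    refine onesDet_eq_zero_of_orthogonal (α := h₁ * ((s + v) * (s + w)))
      (β := h₂ * ((s + w) * (s + u))) (γ := h₃ * ((s + u) * (s + v))) ?_ hP' ?_ ?_
    · simpa [hu, hv, hw] using hh
    · linear_combination ((s + u) * (s + v) * (s + w)) * hP - s * hP'
    · field_simp
      linear_combination ((s + u) * (s + v) * (s + w)) * hDH
  obtain ⟨m, h1, h2, h3⟩ := proportional_of_onesDet_eq_zero hpqr hd
    (by field_simp; linear_combination hDS) hne hθ
  have k1 : m * u ≠ 0 := h1 ▸ div_ne_zero hu hx
  have k2 : m * v ≠ 0 := h2 ▸ div_ne_zero hv hy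
  have k3 : m * w ≠ 0 := h3 ▸ div_ne_zero hw hz
  have hm := left_ne_zero_of_mul k1
  have hu0 := right_ne_zero_of_mul k1
  have hv0 := right_ne_zero_of_mul k2
  have hw0 := right_ne_zero_of_mul k3
  rw [div_eq_iff hx] at h1
  rw [div_eq_iff hy] at h2
  rw [div_eq_iff hz] at h3
  refine ⟨hu0, hv0, hw0, 1 / (m * u * v * w), ?_, ?_, ?_⟩ <;> field_simp <;> linarith

/-- The algebraic core of the concurrence statement. -/
lemma concurrence_key {p q r s u v w x y z α β γ κ₁ κ₂ κ₃ : ℝ} (hpqr : p + q + r = 1)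
    (hd : p * u + q * v + r * w = 0) (hf : p * x + q * y + r * z = 0)
    {S : ℝ → ℝ → ℝ → ℝ}
    (hS : ∀ x y z, S x y z = p * (s + u) * (y * z) + q * (s + v) * (z * x) + r * (s + w) * (x * y))
    {N W : ℝ} (hN : N = p * u ^ 2 + q * v ^ 2 + r * w ^ 2)
    (hW : W = s * (x + y + z) - (p * u * x + q * v * y + r * w * z) + S x y z)
    (hu : u ≠ 0) (hv : v ≠ 0) (hw : w ≠ 0) (huv : u ≠ v) (hvw : v ≠ w) (hwu : w ≠ u)
    (hθ : onesDet u v w x y z ≠ 0) (hα : ¬(α = 0 ∧ β = 0 ∧ γ = 0)) (hα0 : α + β + γ = 0)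
    (hL : α * x + β * y + γ * z = α * (y * z) + β * (z * x) + γ * (x * y))
    (ht : (α * (y * z) + β * (z * x) + γ * (x * y)) * S u v w =
      (α * (v * w) + β * (w * u) + γ * (u * v)) * S x y z)
    (hκ0 : κ₁ + κ₂ + κ₃ = 0)
    (hX : u * v * w * (κ₁ * u + κ₂ * v + κ₃ * w) =
      N * (κ₁ * (v * w) + κ₂ * (w * u) + κ₃ * (u * v))) :
    s * (κ₁ * (y * z) + κ₂ * (z * x) + κ₃ * (x * y)) + W * (κ₁ * x + κ₂ * y + κ₃ * z) = 0 := by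
  -- The vector `(α, β, γ)` of the conic through `L` is orthogonal to all three rows: by `hα0`, by
  -- incidence with `L`, and by tangency.
  have hstar := onesDet_eq_zero_of_orthogonal (a := x - y * z) (b := y - z * x) (c := z - x * y)
    (x := y * z * S u v w - v * w * S x y z) (y := z * x * S u v w - w * u * S x y z)
    (z := x * y * S u v w - u * v * S x y z) hα hα0 (by linear_combination hL)
    (by linear_combination ht)
  have hkey := onesDet_key hpqr hθ hd hf hS hN hW
  rw [hstar, mul_zero] at hkey
  have hT := (mul_eq_zero.1 hkey).resolve_right hθ
  have := orthogonal_of_onesDet_eq_zero (α := κ₁) (β := κ₂) (γ := κ₃) ?_ hκ0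
    (by linear_combination hX) hT
  · linear_combination this
  -- If the row coming from `X` were constant, then `uv = -N = vw`, against `w ≠ u`.
  · rintro ⟨h12, h23⟩
    have e1 : u * v + N = 0 := by
      refine (mul_eq_zero.1 ?_).resolve_left (mul_ne_zero hw (sub_ne_zero.2 huv))
      linear_combination h12
    have e2 : v * w + N = 0 := by
      refine (mul_eq_zero.1 ?_).resolve_left (mul_ne_zero hu (sub_ne_zero.2 hvw))
      linear_combination h23
    refine hwu ?_
    exact mul_left_cancel₀ hv (by linear_combination e2 - e1)

/-- Vectors `(v w, w u, u v)` with a repeated entry depend on `(1, 1, 1)` and `(u, v, w)`. -/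
lemma exists_comb_of_eq {u v w : ℝ} (h : u = v ∨ v = w ∨ w = u) :
    ∃ a b, v * w = a + b * u ∧ w * u = a + b * v ∧ u * v = a + b * w := by
  rcases h with rfl | rfl | rfl
  · exact ⟨u * w + u ^ 2, -u, by ring, by ring, by ring⟩
  · exact ⟨v ^ 2 + u * v, -v, by ring, by ring, by ring⟩
  · exact ⟨w * v + w ^ 2, -w, by ring, by ring, by ring⟩

/-! ### Homogeneous coordinates in the plane -/

namespace EPlane

@[simp] lemma homog_zero (p : EPlane) : p.homog 0 = p 0 := rfl
@[simp] lemma homog_one (p : EPlane) : p.homog 1 = p 1 := rfl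
@[simp] lemma homog_two (p : EPlane) : p.homog 2 = 1 := rfl

lemma homog_injective : Function.Injective homog := fun p q h => by
  ext i
  fin_cases i
  · exact congrFun h 0
  · exact congrFun h 1

lemma homog_lineMap (p q : EPlane) (t : ℝ) :
    (AffineMap.lineMap p q t : EPlane).homog = (1 - t) • p.homog + t • q.homog := by
  ext i
  fin_cases i <;> simp [AffineMap.lineMap_apply] <;> ring

lemma affineIndependent_cross_ne_zero {A B C : EPlane} (h : AffineIndependent ℝ ![A, B, C]) :
    (B 0 - A 0) * (C 1 - A 1) - (B 1 - A 1) * (C 0 - A 0) ≠ 0 := by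
  intro h0
  rw [affineIndependent_iff_not_collinear_set] at h
  refine h ((collinear_iff_of_mem (p₀ := A) (by simp)).2 ?_)
  by_cases hB : B = A
  · subst hB
    refine ⟨C -ᵥ B, ?_⟩
    rintro p (rfl | rfl | rfl)
    · exact ⟨0, by simp⟩
    · exact ⟨0, by simp⟩
    · exact ⟨1, by simp⟩
  · refine ⟨B -ᵥ A, ?_⟩
    rintro p (rfl | rfl | rfl)
    · exact ⟨0, by simp⟩
    · exact ⟨1, by simp⟩
    · by_cases h1 : B 0 - A 0 = 0
      · have h2 : B 1 - A 1 ≠ 0 := fun h2 => hB <| by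
          ext i
          fin_cases i
          · exact sub_eq_zero.1 h1
          · exact sub_eq_zero.1 h2
        refine ⟨(p 1 - A 1) / (B 1 - A 1), ?_⟩
        ext i
        fin_cases i <;> simp <;> field_simp <;> linarith
      · refine ⟨(p 0 - A 0) / (B 0 - A 0), ?_⟩
        ext i
        fin_cases i <;> simp <;> field_simp <;> linarith

lemma exists_comb {A B C : EPlane} (h : AffineIndependent ℝ ![A, B, C]) (g : Fin 3 → ℝ) :
    ∃ x y z : ℝ, g = x • A.homog + y • B.homog + z • C.homog := by
  have hD := affineIndependent_cross_ne_zero h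
  set D := (B 0 - A 0) * (C 1 - A 1) - (B 1 - A 1) * (C 0 - A 0) with hDdef
  refine ⟨(g 0 * (B 1 - C 1) - g 1 * (B 0 - C 0) + g 2 * (B 0 * C 1 - B 1 * C 0)) / D,
    (g 0 * (C 1 - A 1) - g 1 * (C 0 - A 0) + g 2 * (C 0 * A 1 - C 1 * A 0)) / D,
    (g 0 * (A 1 - B 1) - g 1 * (A 0 - B 0) + g 2 * (A 0 * B 1 - A 1 * B 0)) / D, ?_⟩
  ext i
  fin_cases i <;> simp <;> field_simp <;> rw [hDdef] <;> ring

lemma mem_line_of_homog_eq {P B C : EPlane} {q r : ℝ}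
    (h : P.homog = q • B.homog + r • C.homog) : P ∈ line[ℝ, B, C] := by
  have h2 : q = 1 - r := by
    have := congrFun h 2
    simp at this
    linarith
  subst h2
  rw [← homog_lineMap] at h
  rw [homog_injective h]
  exact AffineMap.lineMap_mem_affineSpan_pair _ _ _

end EPlane

/-! ### Quadratic forms of circles and conics -/

/-- The symmetric matrix of a circle in homogeneous coordinates. -/
noncomputable def EuclideanGeometry.Sphere.mat (ω : Sphere EPlane) : Matrix (Fin 3) (Fin 3) ℝ :=
  !![1, 0, -ω.center 0; 0, 1, -ω.center 1;
    -ω.center 0, -ω.center 1, ω.center 0 ^ 2 + ω.center 1 ^ 2 - ω.radius ^ 2]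

lemma EuclideanGeometry.Sphere.mat_isSymm (ω : Sphere EPlane) : ω.mat.IsSymm := by
  ext i j
  fin_cases i <;> fin_cases j <;> simp [Sphere.mat]

lemma EuclideanGeometry.Sphere.power_eq (ω : Sphere EPlane) (p : EPlane) :
    ω.power p = (p 0 - ω.center 0) ^ 2 + (p 1 - ω.center 1) ^ 2 - ω.radius ^ 2 := by
  rw [Sphere.power, EuclideanSpace.dist_eq, Real.sq_sqrt (by positivity)]
  simp [Real.dist_eq, sq_abs]

lemma EuclideanGeometry.Sphere.power_eq_form (ω : Sphere EPlane) (p : EPlane) :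
    ω.power p = p.homog ⬝ᵥ ω.mat *ᵥ p.homog := by
  rw [Sphere.power_eq]
  simp [Sphere.mat, Matrix.mulVec, dotProduct, Fin.sum_univ_three]
  ring

lemma EuclideanGeometry.Sphere.form_of_infinite (ω : Sphere EPlane) (g : Fin 3 → ℝ) (hg : g 2 = 0) :
    g ⬝ᵥ ω.mat *ᵥ g = g 0 ^ 2 + g 1 ^ 2 := by
  simp [Sphere.mat, Matrix.mulVec, dotProduct, Fin.sum_univ_three, hg]
  ring

lemma EuclideanGeometry.Sphere.power_eq_zero_of_mem {ω : Sphere EPlane} {p : EPlane} (h : p ∈ ω) :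
    ω.power p = 0 := by
  rw [Sphere.power, mem_sphere.1 h, sub_self]

section form
variable {M : Matrix (Fin 3) (Fin 3) ℝ}

lemma form_comm (hM : M.IsSymm) (x y : Fin 3 → ℝ) : x ⬝ᵥ M *ᵥ y = y ⬝ᵥ M *ᵥ x := by
  rw [Matrix.dotProduct_mulVec, ← Matrix.mulVec_transpose, hM.eq, dotProduct_comm]

/-- A symmetric form for which three vectors are isotropic. -/
lemma form_comb (hM : M.IsSymm) {a b c : Fin 3 → ℝ} (ha : a ⬝ᵥ M *ᵥ a = 0)
    (hb : b ⬝ᵥ M *ᵥ b = 0) (hc : c ⬝ᵥ M *ᵥ c = 0) (x y z x' y' z' : ℝ) :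
    (x • a + y • b + z • c) ⬝ᵥ M *ᵥ (x' • a + y' • b + z' • c) =
      (b ⬝ᵥ M *ᵥ c) * (y * z' + z * y') + (c ⬝ᵥ M *ᵥ a) * (z * x' + x * z') +
        (a ⬝ᵥ M *ᵥ b) * (x * y' + y * x') := by
  simp only [Matrix.mulVec_add, Matrix.mulVec_smul, add_dotProduct, smul_dotProduct,
    dotProduct_add, dotProduct_smul, smul_eq_mul, ha, hb, hc, form_comm hM c b, form_comm hM a c,
    form_comm hM b a]
  ring

end form

/-! ### Directed angles in coordinates -/

lemma Complex.im_mul_re_eq_of_two_zsmul_arg_eq {z w : ℂ}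
    (h : (2 : ℤ) • (z.arg : Real.Angle) = (2 : ℤ) • (w.arg : Real.Angle)) :
    z.im * w.re = z.re * w.im := by
  rw [← Complex.norm_mul_cos_arg z, ← Complex.norm_mul_sin_arg z, ← Complex.norm_mul_cos_arg w,
    ← Complex.norm_mul_sin_arg w]
  rw [← Real.Angle.cos_coe z.arg, ← Real.Angle.sin_coe z.arg, ← Real.Angle.cos_coe w.arg,
    ← Real.Angle.sin_coe w.arg]
  rcases Real.Angle.two_zsmul_eq_iff.1 h with h | h <;> rw [h]
  · ring
  · rw [Real.Angle.sin_add_pi, Real.Angle.cos_add_pi]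
    ring

lemma EPlane.areaForm_apply (x y : EPlane) :
    (Module.Oriented.positiveOrientation : Orientation ℝ EPlane (Fin 2)).areaForm x y =
      x 0 * y 1 - x 1 * y 0 := by
  have ho : (Module.Oriented.positiveOrientation : Orientation ℝ EPlane (Fin 2)) =
    (EuclideanSpace.basisFun (Fin 2) ℝ).toBasis.orientation := rfl
  rw [ho, Orientation.areaForm_to_volumeForm,
    Orientation.volumeForm_robust _ (EuclideanSpace.basisFun (Fin 2) ℝ) rfl,
    Module.Basis.det_apply, Matrix.det_fin_two]
  simp [Module.Basis.toMatrix_apply]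
  ring

/-- Doubled oriented angles being equal, in coordinates. -/
lemma cross_mul_inner_eq_of_two_zsmul_angle_eq {b g g' c o : EPlane}
    (h : (2 : ℤ) • ∡ b o g = (2 : ℤ) • ∡ g' o c) :
    ((b 0 - o 0) * (g 1 - o 1) - (b 1 - o 1) * (g 0 - o 0)) *
        ((g' 0 - o 0) * (c 0 - o 0) + (g' 1 - o 1) * (c 1 - o 1)) =
      ((b 0 - o 0) * (g 0 - o 0) + (b 1 - o 1) * (g 1 - o 1)) *
        ((g' 0 - o 0) * (c 1 - o 1) - (g' 1 - o 1) * (c 0 - o 0)) := by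
  have := Complex.im_mul_re_eq_of_two_zsmul_arg_eq h
  simp only [Orientation.kahler_apply_apply, EPlane.areaForm_apply] at this
  simpa [PiLp.inner_apply, mul_comm] using this

/-! ### Projective points and the radical axis -/

lemma mem_projLine_mk {l : Set EPlane} {v : Fin 3 → ℝ} (hv : v ≠ 0)
    (h : v ∈ Submodule.span ℝ (EPlane.homog '' l)) : Projectivization.mk ℝ v hv ∈ projLine l := by
  obtain ⟨a, ha⟩ := Projectivization.exists_smul_eq_mk_rep ℝ v hv
  rw [projLine, Set.mem_ofPred_eq, ← ha]
  exact Submodule.smul_mem _ _ h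

lemma Conic.mem_projPoints_mk (K : Conic) {v : Fin 3 → ℝ} (hv : v ≠ 0)
    (h : v ⬝ᵥ K.mat *ᵥ v = 0) : Projectivization.mk ℝ v hv ∈ K.projPoints := by
  obtain ⟨a, ha⟩ := Projectivization.exists_smul_eq_mk_rep ℝ v hv
  rw [Conic.projPoints, Set.mem_ofPred_eq, ← ha, Units.smul_def, Matrix.mulVec_smul,
    smul_dotProduct, dotProduct_smul, h, smul_zero, smul_zero]

/-- The coefficients of the radical axis of two circles in homogeneous coordinates. -/
noncomputable def radicalVec (Ω ω : Sphere EPlane) : Fin 3 → ℝ :=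
  ![2 * (ω.center 0 - Ω.center 0), 2 * (ω.center 1 - Ω.center 1), Ω.mat 2 2 - ω.mat 2 2]

lemma homog_dotProduct_radicalVec (Ω ω : Sphere EPlane) (p : EPlane) :
    p.homog ⬝ᵥ radicalVec Ω ω = Ω.power p - ω.power p := by
  rw [Sphere.power_eq, Sphere.power_eq]
  simp [radicalVec, Sphere.mat, dotProduct, Fin.sum_univ_three]
  ring

/-- A finite point is a multiple of the `homog` of a point of the axis. A point at infinity is a
difference of two such vectors, which is why one actual point `X` of the axis is required. -/
lemma mem_span_radicalAxis {Ω ω : Sphere EPlane} {X : EPlane} (hX : X ∈ radicalAxis Ω ω)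
    {v : Fin 3 → ℝ} (hv : v ⬝ᵥ radicalVec Ω ω = 0) :
    v ∈ Submodule.span ℝ (EPlane.homog '' radicalAxis Ω ω) := by
  have hmem : ∀ p : EPlane, p.homog ⬝ᵥ radicalVec Ω ω = 0 →
      p.homog ∈ Submodule.span ℝ (EPlane.homog '' radicalAxis Ω ω) := fun p hp =>
    Submodule.subset_span ⟨p, by
      rw [homog_dotProduct_radicalVec, sub_eq_zero] at hp
      exact hp, rfl⟩
  by_cases h2 : v 2 = 0
  · have hvX : v = EPlane.homog !₂[X 0 + v 0, X 1 + v 1] - X.homog := by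
      ext i
      fin_cases i <;> simp [h2]
    have hX0 : X.homog ⬝ᵥ radicalVec Ω ω = 0 := by
      rw [homog_dotProduct_radicalVec, sub_eq_zero]
      exact hX
    rw [hvX]
    refine Submodule.sub_mem _ (hmem _ ?_) (hmem _ hX0)
    rw [hvX, sub_dotProduct, hX0, sub_zero] at hv
    exact hv
  · have hvX : v = v 2 • EPlane.homog !₂[v 0 / v 2, v 1 / v 2] := by
      ext i
      fin_cases i <;> simp <;> field_simp
    rw [hvX]
    refine Submodule.smul_mem _ _ (hmem _ ?_)
    rw [hvX, smul_dotProduct, smul_eq_mul] at hv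
    exact (mul_eq_zero.1 hv).resolve_left h2

/-! ### The frame of two isogonal conjugates -/

lemma EuclideanGeometry.Sphere.two_mul_form (ω : Sphere EPlane) (B C : EPlane) :
    2 * (B.homog ⬝ᵥ ω.mat *ᵥ C.homog) =
      ω.power B + ω.power C - ((B 0 - C 0) ^ 2 + (B 1 - C 1) ^ 2) := by
  rw [Sphere.power_eq, Sphere.power_eq]
  simp [Sphere.mat, Matrix.mulVec, dotProduct, Fin.sum_univ_three]
  ring

/-- Isogonality at the vertex `A`, in barycentric coordinates. -/
lemma mul_sq_eq_of_isogonal {A B C P P' : EPlane} {p q r p' q' r' : ℝ}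
    (hABC : (B 0 - A 0) * (C 1 - A 1) - (B 1 - A 1) * (C 0 - A 0) ≠ 0)
    (hP : P.homog = p • A.homog + q • B.homog + r • C.homog)
    (hP' : P'.homog = p' • A.homog + q' • B.homog + r' • C.homog)
    (h : (2 : ℤ) • ∡ B A P = (2 : ℤ) • ∡ P' A C) :
    q * q' * ((A 0 - B 0) ^ 2 + (A 1 - B 1) ^ 2) =
      r * r' * ((C 0 - A 0) ^ 2 + (C 1 - A 1) ^ 2) := by
  have h := cross_mul_inner_eq_of_two_zsmul_angle_eq h
  have e0 := congrFun hP 0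
  have e1 := congrFun hP 1
  have e2 := congrFun hP 2
  have f0 := congrFun hP' 0
  have f1 := congrFun hP' 1
  have f2 := congrFun hP' 2
  simp at e0 e1 e2 f0 f1 f2
  have hp : p = 1 - q - r := by linarith
  have hp' : p' = 1 - q' - r' := by linarith
  subst hp hp'
  rw [e0, e1, f0, f1] at h
  refine mul_left_cancel₀ hABC ?_
  linear_combination -h

/-- Coordinates adapted to a triangle, its circumcircle and a pair of isogonal conjugates: in the
basis `a, b, c` the point `P` is `(1, 1, 1)`, `P'` is `(s + u, s + v, s + w)` up to a factor. -/
lemma exists_isogonal_frame {A B C P P' : EPlane} (hABC : AffineIndependent ℝ ![A, B, C])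
    {Ω : Sphere EPlane} (hA : A ∈ Ω) (hB : B ∈ Ω) (hC : C ∈ Ω)
    (h : IsIsogonalConjugate A B C P P') (hne : P ≠ P') :
    ∃ p q r s u v w : ℝ, p ≠ 0 ∧ q ≠ 0 ∧ r ≠ 0 ∧ s ≠ 0 ∧ s + u ≠ 0 ∧ s + v ≠ 0 ∧ s + w ≠ 0 ∧
      p + q + r = 1 ∧ p * u + q * v + r * w = 0 ∧ ¬(u = 0 ∧ v = 0 ∧ w = 0) ∧
      P.homog = p • A.homog + q • B.homog + r • C.homog ∧
      s • P'.homog = (s + u) • p • A.homog + (s + v) • q • B.homog + (s + w) • r • C.homog ∧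
      2 * (q * r) * (B.homog ⬝ᵥ Ω.mat *ᵥ C.homog) = p * (s + u) ∧
      2 * (r * p) * (C.homog ⬝ᵥ Ω.mat *ᵥ A.homog) = q * (s + v) ∧
      2 * (p * q) * (A.homog ⬝ᵥ Ω.mat *ᵥ B.homog) = r * (s + w) := by
  have hΔ := EPlane.affineIndependent_cross_ne_zero hABC
  obtain ⟨p, q, r, hP⟩ := EPlane.exists_comb hABC P.homog
  obtain ⟨p', q', r', hP'⟩ := EPlane.exists_comb hABC P'.homog
  have hp : p ≠ 0 := fun h0 => h.left_not_mem_BC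
    (EPlane.mem_line_of_homog_eq (q := q) (r := r) (by simpa [h0] using hP))
  have hq : q ≠ 0 := fun h0 => h.left_not_mem_CA
    (EPlane.mem_line_of_homog_eq (q := r) (r := p) (by rw [hP, h0]; module))
  have hr : r ≠ 0 := fun h0 => h.left_not_mem_AB
    (EPlane.mem_line_of_homog_eq (q := p) (r := q) (by simpa [h0] using hP))
  have hp' : p' ≠ 0 := fun h0 => h.right_not_mem_BC
    (EPlane.mem_line_of_homog_eq (q := q') (r := r') (by simpa [h0] using hP'))
  have hq' : q' ≠ 0 := fun h0 => h.right_not_mem_CA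
    (EPlane.mem_line_of_homog_eq (q := r') (r := p') (by rw [hP', h0]; module))
  have hr' : r' ≠ 0 := fun h0 => h.right_not_mem_AB
    (EPlane.mem_line_of_homog_eq (q := p') (r := q') (by simpa [h0] using hP'))
  have hpqr : p + q + r = 1 := by simpa using (congrFun hP 2).symm
  have hpqr' : p' + q' + r' = 1 := by simpa using (congrFun hP' 2).symm
  have iA := mul_sq_eq_of_isogonal hΔ hP hP' h.angle_A
  have iB := mul_sq_eq_of_isogonal (A := B) (B := C) (C := A) (p := q) (q := r) (r := p)
    (p' := q') (q' := r') (r' := p') (fun h0 => hΔ (by linear_combination h0))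
    (by rw [hP]; module) (by rw [hP']; module) h.angle_B
  have iC := mul_sq_eq_of_isogonal (A := C) (B := A) (C := B) (p := r) (q := p) (r := q)
    (p' := r') (q' := p') (r' := q') (fun h0 => hΔ (by linear_combination h0))
    (by rw [hP]; module) (by rw [hP']; module) h.angle_C
  have fBC := Ω.two_mul_form B C
  have fCA := Ω.two_mul_form C A
  have fAB := Ω.two_mul_form A B
  rw [Sphere.power_eq_zero_of_mem hA] at fAB fCA
  rw [Sphere.power_eq_zero_of_mem hB] at fAB fBC
  rw [Sphere.power_eq_zero_of_mem hC] at fBC fCA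
  have hBC : (B 0 - C 0) ^ 2 + (B 1 - C 1) ^ 2 ≠ 0 := fun h0 => hΔ <| by
    have h1 : B 0 - C 0 = 0 := by nlinarith [sq_nonneg (B 0 - C 0), sq_nonneg (B 1 - C 1)]
    have h2 : B 1 - C 1 = 0 := by nlinarith [sq_nonneg (B 0 - C 0), sq_nonneg (B 1 - C 1)]
    linear_combination (C 1 - A 1) * h1 - (C 0 - A 0) * h2
  generalize (B 0 - C 0) ^ 2 + (B 1 - C 1) ^ 2 = a at *
  generalize (C 0 - A 0) ^ 2 + (C 1 - A 1) ^ 2 = b at *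
  generalize (A 0 - B 0) ^ 2 + (A 1 - B 1) ^ 2 = c at *
  -- This is the power of `P` with respect to `Ω`. Isogonality makes `(p', q', r')` proportional to
  -- `(qr a, rp b, pq c)`, and `p' + q' + r' = 1` fixes the factor as `-1 / s`.
  obtain ⟨s, hs⟩ : ∃ s, s = -(q * r * a + r * p * b + p * q * c) := ⟨_, rfl⟩
  have h1 : q * r * (0 + 0 - a) = s * p' := by
    rw [hs]
    linear_combination (q * r * a) * hpqr' + r * iC - q * iB
  have h2 : r * p * (0 + 0 - b) = s * q' := by
    rw [hs]
    linear_combination (r * p * b) * hpqr' + p * iA - r * iC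
  have h3 : p * q * (0 + 0 - c) = s * r' := by
    rw [hs]
    linear_combination (p * q * c) * hpqr' + q * iB - p * iA
  have hs0 : s ≠ 0 := by
    rintro rfl
    simp [hq, hr, hBC] at h1
  have e1 : s + s * (p' / p - 1) = s * (p' / p) := by ring
  have e2 : s + s * (q' / q - 1) = s * (q' / q) := by ring
  have e3 : s + s * (r' / r - 1) = s * (r' / r) := by ring
  refine ⟨p, q, r, s, s * (p' / p - 1), s * (q' / q - 1), s * (r' / r - 1), hp, hq, hr, hs0,
    ?_, ?_, ?_, hpqr, ?_, ?_, hP, ?_, ?_, ?_, ?_⟩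
  · rw [e1]; exact mul_ne_zero hs0 (div_ne_zero hp' hp)
  · rw [e2]; exact mul_ne_zero hs0 (div_ne_zero hq' hq)
  · rw [e3]; exact mul_ne_zero hs0 (div_ne_zero hr' hr)
  · field_simp
    linear_combination s * (hpqr' - hpqr)
  · rintro ⟨k1, k2, k3⟩
    simp only [mul_eq_zero, hs0, false_or, sub_eq_zero] at k1 k2 k3
    rw [div_eq_one_iff_eq hp] at k1
    rw [div_eq_one_iff_eq hq] at k2
    rw [div_eq_one_iff_eq hr] at k3
    exact hne (EPlane.homog_injective (by rw [hP, hP', k1, k2, k3]))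
  · rw [e1, e2, e3, hP', smul_smul, smul_smul, smul_smul, mul_assoc, mul_assoc, mul_assoc,
      div_mul_cancel₀ _ hp, div_mul_cancel₀ _ hq, div_mul_cancel₀ _ hr]
    module
  · rw [e1]
    linear_combination q * r * fBC + h1 - s * mul_div_cancel₀ p' hp
  · rw [e2]
    linear_combination r * p * fCA + h2 - s * mul_div_cancel₀ q' hq
  · rw [e3]
    linear_combination p * q * fAB + h3 - s * mul_div_cancel₀ r' hr

/-- The vector with coordinates `x, y, z` in the basis `p A, q B, r C`. -/
def scaledComb (A B C : EPlane) (p q r x y z : ℝ) : Fin 3 → ℝ :=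
  x • p • A.homog + y • q • B.homog + z • r • C.homog

lemma exists_eq_scaledComb {A B C : EPlane} (h : AffineIndependent ℝ ![A, B, C]) {p q r : ℝ}
    (hp : p ≠ 0) (hq : q ≠ 0) (hr : r ≠ 0) (g : Fin 3 → ℝ) :
    ∃ x y z, g = scaledComb A B C p q r x y z := by
  obtain ⟨x, y, z, rfl⟩ := EPlane.exists_comb h g
  refine ⟨x / p, y / q, z / r, ?_⟩
  simp only [scaledComb, smul_smul, div_mul_cancel₀ _ hp, div_mul_cancel₀ _ hq,
    div_mul_cancel₀ _ hr]

lemma form_scaledComb {M : Matrix (Fin 3) (Fin 3) ℝ} (hM : M.IsSymm) {A B C : EPlane}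
    (hA : A.homog ⬝ᵥ M *ᵥ A.homog = 0) (hB : B.homog ⬝ᵥ M *ᵥ B.homog = 0)
    (hC : C.homog ⬝ᵥ M *ᵥ C.homog = 0) (p q r x y z x' y' z' : ℝ) :
    scaledComb A B C p q r x y z ⬝ᵥ M *ᵥ scaledComb A B C p q r x' y' z' =
      q * r * (B.homog ⬝ᵥ M *ᵥ C.homog) * (y * z' + z * y') +
      r * p * (C.homog ⬝ᵥ M *ᵥ A.homog) * (z * x' + x * z') +
      p * q * (A.homog ⬝ᵥ M *ᵥ B.homog) * (x * y' + y * x') := by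
  simp only [scaledComb, smul_smul]
  rw [form_comb hM hA hB hC]
  ring

/-- Vanishing at `A, B, C` kills the diagonal coefficients, and vanishing at `P = (1, 1, 1)` makes
the other three sum to zero. They are not all zero, as otherwise the whole matrix would vanish. -/
lemma Conic.exists_coords (K : Conic) {A B C P : EPlane} (h : AffineIndependent ℝ ![A, B, C])
    {p q r : ℝ} (hp : p ≠ 0) (hq : q ≠ 0) (hr : r ≠ 0) (hP : P.homog = scaledComb A B C p q r 1 1 1)
    (hA : A ∈ K.points) (hB : B ∈ K.points) (hC : C ∈ K.points) (hPK : P ∈ K.points) :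
    ∃ α β γ : ℝ, ¬(α = 0 ∧ β = 0 ∧ γ = 0) ∧ α + β + γ = 0 ∧ ∀ x y z x' y' z' : ℝ,
      scaledComb A B C p q r x y z ⬝ᵥ K.mat *ᵥ scaledComb A B C p q r x' y' z' =
        α * (y * z' + z * y') + β * (z * x' + x * z') + γ * (x * y' + y * x') := by
  refine ⟨_, _, _, ?_, ?_, form_scaledComb K.symm hA hB hC p q r⟩
  · rintro ⟨h1, h2, h3⟩
    refine K.ne_zero ?_
    ext i j
    obtain ⟨x, y, z, e1⟩ := exists_eq_scaledComb h hp hq hr (Pi.single i 1)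
    obtain ⟨x', y', z', e2⟩ := exists_eq_scaledComb h hp hq hr (Pi.single j 1)
    have := form_scaledComb K.symm hA hB hC p q r x y z x' y' z'
    rw [h1, h2, h3, ← e1, ← e2] at this
    simpa using this
  · have h0 : P.homog ⬝ᵥ K.mat *ᵥ P.homog = 0 := hPK
    rw [hP, form_scaledComb K.symm hA hB hC] at h0
    linarith

/-! ### Tangency of a circle and a conic -/

lemma EPlane.cross_eq_zero_of_homog_comb {P Q X : EPlane} {m n : ℝ}
    (h : X.homog = m • P.homog + n • Q.homog) :
    (Q 0 - P 0) * (X 1 - P 1) - (Q 1 - P 1) * (X 0 - P 0) = 0 := by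
  have e0 := congrFun h 0
  have e1 := congrFun h 1
  have e2 := congrFun h 2
  simp at e0 e1 e2
  have hm : m = 1 - n := by linarith
  subst hm
  rw [e0, e1]
  ring

lemma EPlane.eq_of_sq_eq_zero {P Q : EPlane} (h : (Q 0 - P 0) ^ 2 + (Q 1 - P 1) ^ 2 = 0) :
    Q = P := by
  ext i
  fin_cases i <;> simp <;> nlinarith [sq_nonneg (Q 0 - P 0), sq_nonneg (Q 1 - P 1)]

/-- Gives the tangent functional of the circle at `P` on a chord from `P` in terms of the squared
length of the chord alone. -/
lemma EuclideanGeometry.Sphere.two_mul_inner_eq {ω : Sphere EPlane} {P R : EPlane} (hP : P ∈ ω)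
    (hR : R ∈ ω) :
    2 * ((P 0 - ω.center 0) * (R 0 - P 0) + (P 1 - ω.center 1) * (R 1 - P 1)) =
      -((R 0 - P 0) ^ 2 + (R 1 - P 1) ^ 2) := by
  have h1 := Sphere.power_eq_zero_of_mem hP
  have h2 := Sphere.power_eq_zero_of_mem hR
  rw [Sphere.power_eq] at h1 h2
  linear_combination h2 - h1

lemma form_eq_of_form_self_eq_zero {M : Matrix (Fin 3) (Fin 3) ℝ} {P : EPlane}
    (hP : P.homog ⬝ᵥ M *ᵥ P.homog = 0) (R : EPlane) :
    R.homog ⬝ᵥ M *ᵥ P.homog =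
      (M *ᵥ P.homog) 0 * (R 0 - P 0) + (M *ᵥ P.homog) 1 * (R 1 - P 1) := by
  rw [← sub_zero (R.homog ⬝ᵥ M *ᵥ P.homog), ← hP]
  generalize M *ᵥ P.homog = n
  simp [dotProduct, Fin.sum_univ_three]
  ring

/-- A circle and a conic through `P` are tangent at `P` once the gradients are parallel. -/
lemma areTangentAt_of_cross_eq_zero {ω : Sphere EPlane} {E : Conic} {P : EPlane} (hω : P ∈ ω)
    (hE : P ∈ E.points) (hn : E.mat *ᵥ P.homog ≠ 0) (hm : P ≠ ω.center)
    (h : (E.mat *ᵥ P.homog) 0 * (P 1 - ω.center 1) -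
      (E.mat *ᵥ P.homog) 1 * (P 0 - ω.center 0) = 0) : AreTangentAt ω E P := by
  refine ⟨hω, ⟨hE, hn⟩, ?_⟩
  have hPE : P.homog ⬝ᵥ E.mat *ᵥ P.homog = 0 := hE
  -- If the first two entries vanished, `P` being on the conic would force the third to vanish too,
  -- since the last coordinate of `P.homog` is `1`.
  have hn' : (E.mat *ᵥ P.homog) 0 ≠ 0 ∨ (E.mat *ᵥ P.homog) 1 ≠ 0 := by
    by_contra! hc
    refine hn ?_
    generalize E.mat *ᵥ P.homog = n at *
    ext i
    fin_cases i
    · exact hc.1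
    · exact hc.2
    · simpa [dotProduct, Fin.sum_univ_three, hc.1, hc.2] using hPE
  have hm' : P 0 - ω.center 0 ≠ 0 ∨ P 1 - ω.center 1 ≠ 0 := by
    by_contra! hc
    refine hm (EPlane.eq_of_sq_eq_zero ?_)
    rw [hc.1, hc.2]
    ring
  ext R
  rw [SetLike.mem_coe, Sphere.mem_orthRadius_iff_inner_left, Conic.tangentLine,
    Set.mem_ofPred_eq, form_eq_of_form_self_eq_zero hPE]
  simp only [PiLp.inner_apply, Fin.sum_univ_two, vsub_eq_sub, PiLp.sub_apply, RCLike.inner_apply,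
    conj_trivial]
  constructor <;> intro hR
  · rcases hm' with h0 | h0 <;> refine (mul_eq_zero.1 ?_).resolve_left h0
    · linear_combination (E.mat *ᵥ P.homog) 0 * hR - (R 1 - P 1) * h
    · linear_combination (E.mat *ᵥ P.homog) 1 * hR + (R 0 - P 0) * h
  · rcases hn' with h0 | h0 <;> refine (mul_eq_zero.1 ?_).resolve_left h0
    · linear_combination (P 0 - ω.center 0) * hR + (R 1 - P 1) * h
    · linear_combination (P 1 - ω.center 1) * hR - (R 0 - P 0) * h

lemma scaledComb_two (A B C : EPlane) (p q r x y z : ℝ) :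
    scaledComb A B C p q r x y z 2 = p * x + q * y + r * z := by
  simp [scaledComb]
  ring

lemma eq_of_homog_eq_smul {D A : EPlane} {c : ℝ} (h : D.homog = c • A.homog) : D = A := by
  have h2 := congrFun h 2
  simp at h2
  refine EPlane.homog_injective ?_
  rw [h, ← h2, one_smul]

/-- Coordinates of the second intersection of the circumcircle with the line through `P` and the
fourth common point of the circumcircle and the circumconic. -/
lemma exists_second_point_factor {p q r s u v w δ t N : ℝ} {S : ℝ → ℝ → ℝ → ℝ}
    (hS : ∀ x y z, S x y z = p * (s + u) * (y * z) + q * (s + v) * (z * x) + r * (s + w) * (x * y))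
    (hpqr : p + q + r = 1) (hd : p * u + q * v + r * w = 0) (hs : s ≠ 0)
    (hN : N = p * u ^ 2 + q * v ^ 2 + r * w ^ 2) (ht : t ≠ 0)
    (hD : S (δ * ((s + u) * (v * w))) (δ * ((s + v) * (w * u))) (δ * ((s + w) * (u * v))) = 0)
    (hX : S ((1 - t) * (δ * ((s + u) * (v * w))) + t) ((1 - t) * (δ * ((s + v) * (w * u))) + t)
      ((1 - t) * (δ * ((s + w) * (u * v))) + t) = 0) :
    (1 - t) * δ * (u * v * w) + t = (1 - t) * δ * s * N := by
  -- Twice the polar form of `Ω` at `D` and `P`. As `D` is on `Ω`, the equation for `X` loses its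
  -- `(1 - t)²` term, and the root `t = 0`, which is `D` itself, can be divided out.
  have hDP : p * (s + u) * (δ * ((s + v) * (w * u)) + δ * ((s + w) * (u * v))) +
      q * (s + v) * (δ * ((s + w) * (u * v)) + δ * ((s + u) * (v * w))) +
      r * (s + w) * (δ * ((s + u) * (v * w)) + δ * ((s + v) * (w * u))) =
      δ * (s * (u * v * w - s * N)) := by
    rw [hN]
    linear_combination δ * s * (u * v * w) * hpqr +
      δ * (2 * (u * v * w) + s * (u * v + v * w + w * u) + s ^ 2 * (u + v + w)) * hd
  have h0 : t * s * ((1 - t) * δ * (u * v * w) + t - (1 - t) * δ * s * N) = 0 := by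
    rw [hS] at hD hX
    linear_combination hX - (1 - t) ^ 2 * hD - t * (1 - t) * hDP - t ^ 2 * s * hpqr - t ^ 2 * hd
  exact sub_eq_zero.1 ((mul_eq_zero.1 h0).resolve_left (mul_ne_zero ht hs))

/-! ### The main theorem -/

theorem theorem1p1
    (A B C P P' Q D X : EPlane)
    (hABC : AffineIndependent ℝ ![A, B, C])
    -- the circumcircle of the triangle
    (Ω : Sphere EPlane) (hAΩ : A ∈ Ω) (hBΩ : B ∈ Ω) (hCΩ : C ∈ Ω)
    (hPP' : IsIsogonalConjugate A B C P P') (hne : P ≠ P')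
    (hQ : Q ∈ line[ℝ, P, P'])
    -- the circumconic (ABCPP') and its fourth intersection with the circumcircle
    (H : Conic) (hH : H.Through A B C P P')
    (hDΩ : D ∈ Ω) (hDH : D ∈ H.points) (hDA : D ≠ A) (hDB : D ≠ B) (hDC : D ≠ C)
    -- the second intersection of the line DP with the circumcircle
    (hXΩ : X ∈ Ω) (hXDP : X ∈ line[ℝ, D, P]) (hXD : X ≠ D)
    -- the circle (PQX)
    (hPQX : AffineIndependent ℝ ![P, Q, X])
    (ω : Sphere EPlane) (hPω : P ∈ ω) (hQω : Q ∈ ω) (hXω : X ∈ ω)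
    -- the circumconics (ABCPQ) and (ABCPX)
    (E : Conic) (hE : E.Through A B C P Q)
    (K : Conic) (hK : K.Through A B C P X) :
    AreTangentAt ω E P ∧
      ∀ L : EPlane, L ∈ ω → L ∈ E.points → L ≠ P → L ≠ Q →
        ∃ z : PPlane, z ∈ projLine (line[ℝ, P, L] : Set EPlane) ∧
          z ∈ K.projPoints ∧ z ∈ projLine (radicalAxis Ω ω) := by

  obtain ⟨p, q, r, s, u, v, w, hp, hq, hr, hs, hsu, hsv, hsw, hpqr, hd, hd0, hPc, hP'c, fBC, fCA,
    fAB⟩ := exists_isogonal_frame hABC hAΩ hBΩ hCΩ hPP' hne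
  obtain ⟨S, hS⟩ : ∃ S : ℝ → ℝ → ℝ → ℝ, ∀ x y z, S x y z =
    p * (s + u) * (y * z) + q * (s + v) * (z * x) + r * (s + w) * (x * y) := ⟨_, fun _ _ _ => rfl⟩
  obtain ⟨N, hN⟩ : ∃ N, N = p * u ^ 2 + q * v ^ 2 + r * w ^ 2 := ⟨_, rfl⟩
  obtain ⟨V, hV⟩ : ∃ V, V = scaledComb A B C p q r := ⟨_, rfl⟩
  have hV' : ∀ x y z, V x y z = x • p • A.homog + y • q • B.homog + z • r • C.homog :=
    fun x y z => by rw [hV, scaledComb]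
  have hV2 : ∀ x y z, V x y z 2 = p * x + q * y + r * z := by
    rw [hV]; exact scaledComb_two A B C p q r
  have hspan : ∀ g, ∃ x y z, g = V x y z := by
    rw [hV]; exact exists_eq_scaledComb hABC hp hq hr
  have hPV : P.homog = V 1 1 1 := by simp only [hPc, hV', one_smul]
  have hP'V : s • P'.homog = V (s + u) (s + v) (s + w) := by rw [hP'c, hV']
  have isoΩ : ∀ {Y : EPlane}, Y ∈ Ω → Y.homog ⬝ᵥ Ω.mat *ᵥ Y.homog = 0 := fun hY => by
    rw [← Sphere.power_eq_form, Sphere.power_eq_zero_of_mem hY]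
  have hΩ : ∀ x y z, V x y z ⬝ᵥ Ω.mat *ᵥ V x y z = S x y z := fun x y z => by
    rw [hV, form_scaledComb Ω.mat_isSymm (isoΩ hAΩ) (isoΩ hBΩ) (isoΩ hCΩ), hS]
    linear_combination (y * z) * fBC + (z * x) * fCA + (x * y) * fAB
  have hpow : ∀ {Y : EPlane} {x y z : ℝ}, Y.homog = V x y z → Ω.power Y = S x y z :=
    fun h => by rw [Sphere.power_eq_form, h, hΩ]
  have hsum : ∀ {Y : EPlane} {x y z : ℝ}, Y.homog = V x y z → p * x + q * y + r * z = 1 :=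
    fun {Y x y z} h => by rw [← hV2, ← h, EPlane.homog_two]
  have hSP : S 1 1 1 = s := by
    rw [hS]
    linear_combination s * hpqr + hd
  -- On vectors at infinity the form of any circle is the squared Euclidean length.
  have hdist : ∀ {Y : EPlane} {x y z : ℝ}, Y.homog = V x y z →
      (Y 0 - P 0) ^ 2 + (Y 1 - P 1) ^ 2 = S (x - 1) (y - 1) (z - 1) := fun {Y x y z} h => by
    have e : V (x - 1) (y - 1) (z - 1) = Y.homog - P.homog := by
      rw [h, hPV, hV', hV', hV']; module
    rw [← hΩ, e, Sphere.form_of_infinite]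
    · simp
    · simp
  -- the point `D`
  obtain ⟨h₁, h₂, h₃, hh, hh0, hHf⟩ := H.exists_coords hABC hp hq hr (hV ▸ hPV) hH.1 hH.2.1
    hH.2.2.1 hH.2.2.2.1
  rw [← hV] at hHf
  obtain ⟨x, y, z, hDV⟩ := hspan D.homog
  have hDS : S x y z = 0 := by rw [← hpow hDV, Sphere.power_eq_zero_of_mem hDΩ]
  have hDS' := hDS
  rw [hS] at hDS'
  have hDHf : D.homog ⬝ᵥ H.mat *ᵥ D.homog = 0 := hDH
  rw [hDV, hHf] at hDHf
  have hP'f : P'.homog ⬝ᵥ H.mat *ᵥ P'.homog = 0 := hH.2.2.2.2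
  have hP'f' : V (s + u) (s + v) (s + w) ⬝ᵥ H.mat *ᵥ V (s + u) (s + v) (s + w) = 0 := by
    rw [← hP'V, Matrix.mulVec_smul, smul_dotProduct, dotProduct_smul, hP'f, smul_zero, smul_zero]
  rw [hHf] at hP'f'
  have nA : ¬(y = 0 ∧ z = 0) := fun ⟨h1, h2⟩ => hDA <| eq_of_homog_eq_smul (c := x * p) <| by
    rw [hDV, hV', h1, h2]; module
  have nB : ¬(z = 0 ∧ x = 0) := fun ⟨h1, h2⟩ => hDB <| eq_of_homog_eq_smul (c := y * q) <| by
    rw [hDV, hV', h1, h2]; module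
  have nC : ¬(x = 0 ∧ y = 0) := fun ⟨h1, h2⟩ => hDC <| eq_of_homog_eq_smul (c := z * r) <| by
    rw [hDV, hV', h1, h2]; module
  -- A side line meets `Ω` only at two vertices, and `D` is not a vertex.
  have hx : x ≠ 0 := by
    rintro rfl
    simp [hp, hsu] at hDS' nB nC
    tauto
  have hy : y ≠ 0 := by
    rintro rfl
    simp [hq, hsv] at hDS' nA nC
    tauto
  have hz : z ≠ 0 := by
    rintro rfl
    simp [hr, hsw] at hDS' nA nB
    tauto
  obtain ⟨hu, hv, hw, δ, rfl, rfl, rfl⟩ := fourth_point_coords hpqr hd hd0 hsu hsv hsw hh hh0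
    (by linear_combination hP'f' / 2) hx hy hz (by linear_combination hDHf / 2) hDS'
  -- the point `X`
  obtain ⟨t, rfl⟩ := mem_affineSpan_pair_iff_exists_lineMap_eq.1 hXDP
  set X : EPlane := AffineMap.lineMap D P t with hXdef
  have ht : t ≠ 0 := by
    rintro rfl
    exact hXD (by rw [hXdef, AffineMap.lineMap_apply_zero])
  have hXV₀ : X.homog = V ((1 - t) * (δ * ((s + u) * (v * w))) + t)
      ((1 - t) * (δ * ((s + v) * (w * u))) + t) ((1 - t) * (δ * ((s + w) * (u * v))) + t) := by
    rw [hXdef, EPlane.homog_lineMap, hDV, hPV, hV', hV', hV']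
    module
  have hfac := exists_second_point_factor hS hpqr hd hs hN ht hDS
    (by rw [← hpow hXV₀, Sphere.power_eq_zero_of_mem hXΩ])
  obtain ⟨ρ, hρ⟩ : ∃ ρ, ρ = (1 - t) * δ * s := ⟨_, rfl⟩
  have hXV : X.homog = V (ρ * (v * w + N)) (ρ * (w * u + N)) (ρ * (u * v + N)) := by
    rw [hXV₀, hρ]
    congr 1 <;> linear_combination hfac
  clear_value X
  have hXS : S (ρ * (v * w + N)) (ρ * (w * u + N)) (ρ * (u * v + N)) = 0 := by
    rw [← hpow hXV, Sphere.power_eq_zero_of_mem hXΩ]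
  have hρ1 := hsum hXV
  have hρ0 : ρ ≠ 0 := by
    rintro rfl
    simp at hρ1
  -- The squared length of `PX`, to be compared with `τ ^ 2 * S u v w` for `PQ`.
  have hXP : S (ρ * (v * w + N) - 1) (ρ * (w * u + N) - 1) (ρ * (u * v + N) - 1) =
      ρ * S u v w := by
    have hXP : p * (s + u) * (ρ * (w * u + N) + ρ * (u * v + N)) +
        q * (s + v) * (ρ * (u * v + N) + ρ * (v * w + N)) +
        r * (s + w) * (ρ * (v * w + N) + ρ * (w * u + N)) = ρ * (s * N - u * v * w) := by
      linear_combination ρ * s * hN + ρ * (2 * N * s - u * v * w) * hpqr +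
        ρ * (u * v + v * w + w * u + 2 * N + s * (u + v + w)) * hd
    rw [hS] at hXS ⊢
    rw [hS]
    linear_combination hXS - hXP + (s + s * ρ * N - ρ * (u * v * w)) * hpqr + hd - s * hρ1
  -- the point `Q`
  obtain ⟨k, rfl⟩ := mem_affineSpan_pair_iff_exists_lineMap_eq.1 hQ
  set Q : EPlane := AffineMap.lineMap P P' k with hQdef
  have hcross := EPlane.affineIndependent_cross_ne_zero hPQX
  obtain ⟨τ, hτ⟩ : ∃ τ, τ = k / s := ⟨_, rfl⟩
  have hQV : Q.homog = V (1 + τ * u) (1 + τ * v) (1 + τ * w) := by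
    have hk : k = τ * s := by rw [hτ, div_mul_cancel₀ _ hs]
    rw [hQdef, EPlane.homog_lineMap, hk, mul_smul, hP'V, hPV, hV', hV', hV']
    module
  clear_value Q
  have hτ0 : τ ≠ 0 := by
    rintro rfl
    have : Q = P := EPlane.homog_injective (by rw [hQV, hPV]; simp)
    rw [this] at hcross
    simp at hcross
  have hQP : S (1 + τ * u - 1) (1 + τ * v - 1) (1 + τ * w - 1) = τ ^ 2 * S u v w := by
    rw [hS, hS]; ring
  -- Otherwise `d` would have length zero and `Q` would equal `P`.
  have hSd : S u v w ≠ 0 := by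
    intro h0
    rw [h0, mul_zero, ← hdist hQV] at hQP
    rw [EPlane.eq_of_sq_eq_zero hQP] at hcross
    simp at hcross
  -- With a repeated entry, `(vw, wu, uv)` is a combination of `P` and `d = (Q - P) / τ`, which
  -- would put `X` on line `PQ`.
  have hdist3 : ¬(u = v ∨ v = w ∨ w = u) := by
    intro hc
    obtain ⟨a, b, e1, e2, e3⟩ := exists_comb_of_eq hc
    refine hcross (EPlane.cross_eq_zero_of_homog_comb (m := ρ * (a + N) - ρ * b / τ)
      (n := ρ * b / τ) ?_)
    obtain ⟨b', rfl⟩ : ∃ b', b = b' * τ := ⟨b / τ, by rw [div_mul_cancel₀ _ hτ0]⟩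
    rw [hXV, hPV, hQV, hV', hV', hV', e1, e2, e3, ← mul_assoc ρ, mul_div_cancel_right₀ _ hτ0]
    module
  push Not at hdist3
  obtain ⟨huv, hvw, hwu⟩ := hdist3
  -- the conic `E`
  obtain ⟨α, β, γ, hα, hα0, hEf⟩ := E.exists_coords hABC hp hq hr (hV ▸ hPV) hE.1 hE.2.1
    hE.2.2.1 hE.2.2.2.1
  rw [← hV] at hEf
  have hPE : P.homog ⬝ᵥ E.mat *ᵥ P.homog = 0 := hE.2.2.2.1
  have hQE : Q.homog ⬝ᵥ E.mat *ᵥ Q.homog = 0 := hE.2.2.2.2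
  rw [hQV, hEf] at hQE
  have hτE : α * u + β * v + γ * w = τ * (α * (v * w) + β * (w * u) + γ * (u * v)) := by
    refine mul_left_cancel₀ hτ0 ?_
    linear_combination (-1 / 2) * hQE + (1 + τ * (u + v + w)) * hα0
  have hEP : ∀ {Y : EPlane} {x y z : ℝ}, Y.homog = V x y z →
      (E.mat *ᵥ P.homog) 0 * (Y 0 - P 0) + (E.mat *ᵥ P.homog) 1 * (Y 1 - P 1) =
        -(α * x + β * y + γ * z) := fun {Y x y z} h => by
    rw [← form_eq_of_form_self_eq_zero hPE, h, hPV, hEf]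
    linear_combination (x + y + z) * hα0
  have hn : E.mat *ᵥ P.homog ≠ 0 := by
    intro h0
    have hz : ∀ x y z, α * (y + z) + β * (z + x) + γ * (x + y) = 0 := fun x y z => by
      have := hEf x y z 1 1 1
      rw [← hPV, h0, dotProduct_zero] at this
      linear_combination -this
    refine hα ⟨?_, ?_, ?_⟩
    · linear_combination hα0 - hz 1 0 0
    · linear_combination hα0 - hz 0 1 0
    · linear_combination hα0 - hz 0 0 1
  have hQω' := Sphere.two_mul_inner_eq hPω hQω
  have hXω' := Sphere.two_mul_inner_eq hPω hXω
  rw [hdist hQV, hQP] at hQω'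
  rw [hdist hXV, hXP] at hXω'
  have hm : P ≠ ω.center := by
    intro h0
    rw [← h0] at hQω'
    simp [hτ0, hSd] at hQω'
  have hQt := hEP hQV
  have hXt := hEP hXV
  have e1 : (E.mat *ᵥ P.homog) 0 * (Q 0 - P 0) + (E.mat *ᵥ P.homog) 1 * (Q 1 - P 1) =
      -τ ^ 2 * (α * (v * w) + β * (w * u) + γ * (u * v)) := by
    linear_combination hQt - hα0 - τ * hτE
  have e2 : (E.mat *ᵥ P.homog) 0 * (X 0 - P 0) + (E.mat *ᵥ P.homog) 1 * (X 1 - P 1) =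
      -ρ * (α * (v * w) + β * (w * u) + γ * (u * v)) := by
    linear_combination hXt - ρ * N * hα0
  -- Up to a common factor, both tangent functionals take the values `τ ^ 2` and `ρ` on the
  -- independent vectors `Q - P` and `X - P`.
  have hpar : (E.mat *ᵥ P.homog) 0 * (P 1 - ω.center 1) -
      (E.mat *ᵥ P.homog) 1 * (P 0 - ω.center 0) = 0 := by
    refine mul_right_cancel₀ hcross ?_
    linear_combination
      ((P 0 - ω.center 0) * (X 0 - P 0) + (P 1 - ω.center 1) * (X 1 - P 1)) * e1 -
      ((P 0 - ω.center 0) * (Q 0 - P 0) + (P 1 - ω.center 1) * (Q 1 - P 1)) * e2 +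
      (α * (v * w) + β * (w * u) + γ * (u * v)) / 2 * (ρ * hQω' - τ ^ 2 * hXω')
  refine ⟨areTangentAt_of_cross_eq_zero hPω hE.2.2.2.1 hn hm hpar, fun L hLω hLE hLP hLQ => ?_⟩
  obtain ⟨x₀, y₀, z₀, hLV₀⟩ := hspan L.homog
  -- From here `(x, y, z)` are the coordinates of the vector `L - P`, a vector at infinity.
  obtain ⟨x, rfl⟩ : ∃ x, x₀ = 1 + x := ⟨x₀ - 1, by ring⟩
  obtain ⟨y, rfl⟩ : ∃ y, y₀ = 1 + y := ⟨y₀ - 1, by ring⟩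
  obtain ⟨z, rfl⟩ : ∃ z, z₀ = 1 + z := ⟨z₀ - 1, by ring⟩
  have hf : p * x + q * y + r * z = 0 := by linear_combination hsum hLV₀ - hpqr
  have hLE' : L.homog ⬝ᵥ E.mat *ᵥ L.homog = 0 := hLE
  rw [hLV₀, hEf] at hLE'
  have hLE'' : α * x + β * y + γ * z = α * (y * z) + β * (z * x) + γ * (x * y) := by
    linear_combination (-1 / 2) * hLE' + (1 + x + y + z) * hα0
  have hLω' := Sphere.two_mul_inner_eq hPω hLω
  rw [hdist hLV₀, add_sub_cancel_left, add_sub_cancel_left, add_sub_cancel_left] at hLω'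
  have hLt := hEP hLV₀
  -- The tangent functionals are proportional; comparing their values on `Q - P` and `L - P`
  -- eliminates the factor.
  have htan : (α * (y * z) + β * (z * x) + γ * (x * y)) * S u v w =
      (α * (v * w) + β * (w * u) + γ * (u * v)) * S x y z := by
    have e3 : (E.mat *ᵥ P.homog) 0 * (L 0 - P 0) + (E.mat *ᵥ P.homog) 1 * (L 1 - P 1) =
        -(α * (y * z) + β * (z * x) + γ * (x * y)) := by
      linear_combination hLt - hα0 - hLE''
    refine mul_left_cancel₀ (pow_ne_zero 2 hτ0) ?_
    linear_combination
      (-2) * ((Q 0 - P 0) * (L 1 - P 1) - (Q 1 - P 1) * (L 0 - P 0)) * hpar -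
      2 * ((P 0 - ω.center 0) * (Q 0 - P 0) + (P 1 - ω.center 1) * (Q 1 - P 1)) * e3 +
      (α * (y * z) + β * (z * x) + γ * (x * y)) * hQω' +
      2 * ((P 0 - ω.center 0) * (L 0 - P 0) + (P 1 - ω.center 1) * (L 1 - P 1)) * e1 -
      τ ^ 2 * (α * (v * w) + β * (w * u) + γ * (u * v)) * hLω'
  -- Otherwise `L = P + m d` lies on line `PQ`, which meets the circle only for `m = 0` and `m = τ`,
  -- that is at `P` and `Q`.
  have hθ : onesDet u v w x y z ≠ 0 := by
    intro h0
    obtain ⟨m, rfl, rfl, rfl⟩ := proportional_of_onesDet_eq_zero hpqr hd hf hd0 h0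
    have hm0 : m ≠ 0 := by
      rintro rfl
      exact hLP (EPlane.homog_injective (by rw [hLV₀, hPV]; simp))
    have hmτ : m ≠ τ := by
      rintro rfl
      exact hLQ (EPlane.homog_injective (by rw [hLV₀, hQV]))
    have hcomb : τ • (L.homog - P.homog) = m • (Q.homog - P.homog) := by
      rw [hLV₀, hPV, hQV, hV', hV', hV']
      module
    have g0 := congrFun hcomb 0
    have g1 := congrFun hcomb 1
    simp only [Pi.smul_apply, Pi.sub_apply, smul_eq_mul, EPlane.homog_zero,
      EPlane.homog_one] at g0 g1
    have hSm : S (m * u) (m * v) (m * w) = m ^ 2 * S u v w := by rw [hS, hS]; ring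
    rw [hSm] at hLω'
    refine mul_ne_zero (mul_ne_zero (mul_ne_zero hm0 hτ0) hSd) (sub_ne_zero.2 hmτ) ?_
    linear_combination (-2) * (P 0 - ω.center 0) * g0 - 2 * (P 1 - ω.center 1) * g1 +
      τ * hLω' - m * hQω'
  obtain ⟨κ₁, κ₂, κ₃, -, hκ0, hKf⟩ := K.exists_coords hABC hp hq hr (hV ▸ hPV) hK.1 hK.2.1
    hK.2.2.1 hK.2.2.2.1
  rw [← hV] at hKf
  have hXK : X.homog ⬝ᵥ K.mat *ᵥ X.homog = 0 := hK.2.2.2.2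
  rw [hXV, hKf] at hXK
  have hXK' : u * v * w * (κ₁ * u + κ₂ * v + κ₃ * w) =
      N * (κ₁ * (v * w) + κ₂ * (w * u) + κ₃ * (u * v)) := by
    refine mul_left_cancel₀ (pow_ne_zero 2 hρ0) ?_
    linear_combination hXK / 2 - ρ ^ 2 * (N ^ 2 + N * (u * v + v * w + w * u)) * hκ0
  have key := concurrence_key hpqr hd hf hS hN rfl hu hv hw huv hvw hwu hθ hα hα0 hLE'' htan hκ0
    hXK'
  have hSL : S (1 + x) (1 + y) (1 + z) - s =
      s * (x + y + z) - (p * u * x + q * v * y + r * w * z) + S x y z := by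
    rw [hS, hS]
    linear_combination (s + s * (x + y + z)) * hpqr + (1 + (x + y + z)) * hd - s * hf
  rw [← hSL] at key
  -- The combination of `P` and `L` at which the difference of the two powers, `s` at `P` and `S(L)`
  -- at `L`, cancels. It is at infinity when `S(L) = s`.
  obtain ⟨Z, hZ⟩ : ∃ Z, Z = S (1 + x) (1 + y) (1 + z) • P.homog - s • L.homog := ⟨_, rfl⟩
  have hZ0 : Z ≠ 0 := by
    intro h0
    rw [hZ, sub_eq_zero] at h0
    have h2 := congrFun h0 2
    simp only [Pi.smul_apply, EPlane.homog_two, smul_eq_mul, mul_one] at h2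
    rw [h2] at h0
    exact hLP (EPlane.homog_injective (smul_right_injective _ hs h0).symm)
  refine ⟨Projectivization.mk ℝ Z hZ0, mem_projLine_mk hZ0 ?_, K.mem_projPoints_mk hZ0 ?_,
    mem_projLine_mk hZ0 (mem_span_radicalAxis (X := X) ?_ ?_)⟩
  · rw [hZ]
    exact Submodule.sub_mem _
      (Submodule.smul_mem _ _ (Submodule.subset_span ⟨P, left_mem_affineSpan_pair ℝ P L, rfl⟩))
      (Submodule.smul_mem _ _ (Submodule.subset_span ⟨L, right_mem_affineSpan_pair ℝ P L, rfl⟩))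
  · obtain ⟨W, hW⟩ : ∃ W, W = S (1 + x) (1 + y) (1 + z) - s := ⟨_, rfl⟩
    have hZV : Z = V (W - s * x) (W - s * y) (W - s * z) := by
      rw [hZ, hPV, hLV₀, hV', hV', hV', hW]
      module
    rw [← hW] at key
    rw [hZV, hKf]
    linear_combination 2 * s * key + (2 * W ^ 2 - 2 * W * s * (x + y + z)) * hκ0
  · rw [radicalAxis, Set.mem_ofPred_eq, Sphere.power_eq_zero_of_mem hXΩ,
      Sphere.power_eq_zero_of_mem hXω]
  · rw [hZ, sub_dotProduct, smul_dotProduct, smul_dotProduct, homog_dotProduct_radicalVec,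
      homog_dotProduct_radicalVec, Sphere.power_eq_zero_of_mem hPω,
      Sphere.power_eq_zero_of_mem hLω, hpow hPV, hpow hLV₀, hSP]
    simp only [smul_eq_mul]
    ring
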